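/- **Setting.** Let $G$ be a compact abelian topological group (written additively) with normalized Haar measure $dt$, let $L^p=L^p(G,dt;\mathbb C)$, let $\widehat G$ be the dual group with characters $t\mapsto\langle\xi,t\rangle$, and let $(\mathcal F x)_\xi=\int_G x(t)\,\overline{\langle\xi,t\rangle}\,dt$ and $(x*y)(t)=\int_G x(\tau)\,y(t-\tau)\,d\tau$. Let $(\widehat K_\xi)_{\xi\in\widehat G}$ be real numbers with $0\le\widehat K_\xi\le D_K^2$ for some $D_K>0$. Let $$\mathcal H=\Big\{w\in L^2 : (\mathcal F w)_\xi=0 \text{ whenever } \widehat K_\xi=0,\ \sum_{\xi:\widehat K_\xi\ne0}\frac{|(\mathcal F w)_\xi|^2}{\widehat K_\xi}<\infty\Big\},\qquad \langle w,w'\rangle_{\mathcal H}=\sum_{\xi:\widehat K_\xi\neq0}\frac{(\mathcal F w)_\xi\overline{(\mathcal F w')_\xi}}{\widehat K_\xi},$$ a Hilbert space with continuous embedding $j:\mathcal H\to L^2$. Let $n\ge1$, $X_1,\dots,X_n\in L^1$ and $Y_1,\dots,Y_n\in L^2$ (any realization of the training set). Let $\oplus_1^nL^2$ carry the norm $\|\oplus_i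 y_i\|_n^2=\frac1n\sum_{i=1}^n\|y_i\|_2^2$, and put $$S_n:\mathcal H\to\oplus_1^nL^2,\quad S_nw=\oplus_{i=1}^n\,X_i*j(w),\qquad T_n=S_n^*S_n,\qquad \mathbf Y=\oplus_{i=1}^nY_i.$$ **Proposition.** Let $\lambda>0$. The functional $$\mathcal H\ni w\mapsto\frac1n\sum_{i=1}^n\|X_i*j(w)-Y_i\|_2^2+\lambda\|w\|_{\mathcal H}^2$$ has exactly one minimizer $w_n^\lambda$ (the ridge estimator), the operator $T_n+\lambda I$ is invertible in the bounded operators on $\mathcal H$, and $$w_n^\lambda=(T_n+\lambda I)^{-1}S_n^*\mathbf Y .$$ Moreover, for every $\xi\in\widehat G$, $$(\mathcal F\,j(w_n^\lambda))_\xi=\begin{cases}\dfrac{\frac1n\sum_{i=1}^n(\mathcal F Y_i)_\xi\,\overline{(\mathcal F X_i)_\xi}}{\frac1n\sum_{i=1}^n|(\mathcal F X_i)_\xi|^2+\lambda\,\widehat K_\xi^{-1}}&\text{if }\widehat K_\xi\ne0,\\[2ex]0&\text{if }\widehat K_\xi=0.\end{cases}$$ -/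

import Mathlib

set_option linter.overlappingInstances false
set_option linter.unusedSectionVars false

open MeasureTheory Filter Topology
open scoped ENNReal ComplexConjugate InnerProductSpace BoundedContinuousFunction

noncomputable section

/-! Ridge regression for convolution operators on a compact abelian group.

`G` is a compact abelian topological group, written additively, with its Borel σ-algebra, and `μ` is
its normalised Haar measure (the regular translation invariant Borel probability measure). The group
is not assumed to be second countable. -/

namespace RidgeConv

variable {G : Type*} [AddCommGroup G] [TopologicalSpace G] [IsTopologicalAddGroup G]
  [CompactSpace G] [MeasurableSpace G] [BorelSpace G]

/-! ### The dual group, the Fourier transform and translations -/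

/-- The dual group `Ĝ`: continuous homomorphisms from `G` to the unit circle. `Multiplicative G` is
`G` with its group law written multiplicatively. -/
abbrev DualGroup (G : Type*) [AddCommGroup G] [TopologicalSpace G] : Type _ :=
  PontryaginDual (Multiplicative G)

/-- The character `t ↦ ⟨ξ, t⟩` as a continuous complex function on `G`. -/
def character (ξ : DualGroup G) : C(G, ℂ) where
  toFun t := (ξ (Multiplicative.ofAdd t) : ℂ)
  continuous_toFun :=
    continuous_subtype_val.comp ((map_continuous ξ).comp continuous_ofAdd)

section L2
variable (μ : Measure G) [μ.IsAddHaarMeasure] [IsProbabilityMeasure μ] [μ.Regular]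

/-- The Fourier transform `(F f)_ξ = ∫ f(t) conj ⟨ξ, t⟩ dt`. -/
def groupFourier (f : G → ℂ) (ξ : DualGroup G) : ℂ :=
  ∫ t, f t * conj (character ξ t) ∂μ

/-- The translation `(T_s u)(t) = u(t - s)` on `L²`. -/
def translate (s : G) : Lp ℂ 2 μ →ₗᵢ[ℂ] Lp ℂ 2 μ :=
  Lp.compMeasurePreservingₗᵢ ℂ (fun t => t - s) (measurePreserving_sub_right μ s)

variable {μ}

lemma translate_ae (s : G) (u : Lp ℂ 2 μ) : translate μ s u =ᵐ[μ] fun t => u (t - s) :=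
  Lp.coeFn_compMeasurePreserving u _

lemma continuous_translate (u : Lp ℂ 2 μ) : Continuous fun s => translate μ s u := by
  let g : C(G, C(G, G)) := (ContinuousMap.mk (fun p : G × G => p.2 - p.1) (by fun_prop)).curry
  exact Continuous.compMeasurePreservingLp (g := g) continuous_const g.continuous
    (fun s => measurePreserving_sub_right μ s) (by simp)

lemma integrable_translate {a : G → ℂ} (ha : Integrable a μ) (u : Lp ℂ 2 μ) :
    Integrable (fun s => a s • translate μ s u) μ :=
  ha.smul_bdd (C := ‖u‖)
    ((continuous_translate u).stronglyMeasurable_of_hasCompactSupport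
      (.of_compactSpace _)).aestronglyMeasurable
    (ae_of_all _ fun s => by simp)

/-- The average `∫ a(s) T_s u ds` of the translates of `u ∈ L²`, as a Bochner integral in `L²`. It is
used to prove that convolution with an `L¹` function is a bounded operator on `L²`. -/
def avgTranslate {a : G → ℂ} (ha : Integrable a μ) : Lp ℂ 2 μ →L[ℂ] Lp ℂ 2 μ :=
  LinearMap.mkContinuous
    { toFun := fun u => ∫ s, a s • translate μ s u ∂μ
      map_add' := fun u v => by
        rw [← integral_add (integrable_translate ha u) (integrable_translate ha v)]
        simp
      map_smul' := fun c u => by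
        rw [RingHom.id_apply, ← integral_smul]
        simp [smul_comm c] }
    (∫ s, ‖a s‖ ∂μ) fun u => by
      refine (norm_integral_le_integral_norm _).trans (le_of_eq ?_)
      rw [← integral_mul_const]
      simp [norm_smul]

lemma avgTranslate_apply {a : G → ℂ} (ha : Integrable a μ) (u : Lp ℂ 2 μ) :
    avgTranslate ha u = ∫ s, a s • translate μ s u ∂μ := rfl

lemma norm_avgTranslate_le {a : G → ℂ} (ha : Integrable a μ) (u : Lp ℂ 2 μ) :
    ‖avgTranslate ha u‖ ≤ (∫ s, ‖a s‖ ∂μ) * ‖u‖ :=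
  (norm_integral_le_integral_norm _).trans <| le_of_eq <| by
    rw [← integral_mul_const]
    simp [norm_smul]

/-- The map `t ↦ (s ↦ conj (x (t - s)))` from `G` to `L²`. -/
def reflTranslate (x : Lp ℂ 2 μ) : C(G, Lp ℂ 2 μ) where
  toFun t := Lp.compMeasurePreserving (fun s => t - s) (Measure.measurePreserving_sub_left μ t) (star x)
  continuous_toFun := by
    let g : C(G, C(G, G)) := (ContinuousMap.mk (fun p : G × G => p.1 - p.2) (by fun_prop)).curry
    exact Continuous.compMeasurePreservingLp (g := g) continuous_const g.continuous
      (fun s => Measure.measurePreserving_sub_left μ s) (by simp)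

lemma inner_reflTranslate (x y : Lp ℂ 2 μ) (t : G) :
    ⟪reflTranslate x t, y⟫_ℂ = ∫ s, x s * y (t - s) ∂μ := by
  rw [← integral_sub_left_eq_self (fun s => x s * y (t - s)) μ t, L2.inner_def]
  refine integral_congr_ae ?_
  have h1 : reflTranslate x t =ᵐ[μ] fun s => (star x : Lp ℂ 2 μ) (t - s) :=
    Lp.coeFn_compMeasurePreserving (star x) _
  have h2 : (fun s => (star x : Lp ℂ 2 μ) (t - s)) =ᵐ[μ] fun s => star (x (t - s)) :=
    (Measure.measurePreserving_sub_left μ t).quasiMeasurePreserving.ae_eq_comp (Lp.coeFn_star x)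
  filter_upwards [h1, h2] with s h1 h2
  simp [h1, h2, mul_comm]

/-- The operator `y ↦ (t ↦ ⟨ψ t, y⟩)` from `L²` to the continuous functions. -/
def kernelOp (ψ : C(G, Lp ℂ 2 μ)) : Lp ℂ 2 μ →L[ℂ] (G →ᵇ ℂ) :=
  LinearMap.mkContinuous
    { toFun := fun y => BoundedContinuousFunction.mkOfCompact
        ⟨fun t => ⟪ψ t, y⟫_ℂ, by fun_prop⟩
      map_add' := fun u v => by ext t; simp [inner_add_right]
      map_smul' := fun c u => by ext t; simp [inner_smul_right] }
    ‖ψ‖ fun y => by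
      refine (BoundedContinuousFunction.norm_le (by positivity)).2 fun t => ?_
      refine (norm_inner_le_norm (ψ t) y).trans ?_
      gcongr
      exact ψ.norm_coe_le_norm t

lemma kernelOp_apply (ψ : C(G, Lp ℂ 2 μ)) (y : Lp ℂ 2 μ) (t : G) :
    kernelOp ψ y t = ⟪ψ t, y⟫_ℂ := rfl

lemma isCompactOperator_kernelOp (ψ : C(G, Lp ℂ 2 μ)) : IsCompactOperator (kernelOp ψ) := by
  refine (isCompactOperator_iff_isCompact_closure_image_closedBall
    (kernelOp ψ : Lp ℂ 2 μ →ₗ[ℂ] (G →ᵇ ℂ)) one_pos).2 ?_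
  refine BoundedContinuousFunction.arzela_ascoli (Metric.closedBall 0 ‖ψ‖)
    (isCompact_closedBall _ _) _ ?_ ?_
  · rintro _ t ⟨y, hy, rfl⟩
    rw [mem_closedBall_zero_iff] at hy ⊢
    refine (norm_inner_le_norm (ψ t) y).trans ?_
    nlinarith [ψ.norm_coe_le_norm t, norm_nonneg (ψ t), norm_nonneg y]
  · intro t₀
    rw [Metric.equicontinuousAt_iff_right]
    intro ε hε
    filter_upwards [Metric.tendsto_nhds.1 (ψ.continuous.tendsto t₀) ε hε] with t ht
    rintro ⟨_, y, hy, rfl⟩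
    rw [mem_closedBall_zero_iff] at hy
    change dist ⟪ψ t₀, y⟫_ℂ ⟪ψ t, y⟫_ℂ < ε
    rw [dist_comm, dist_eq_norm, ← inner_sub_left]
    refine (norm_inner_le_norm _ y).trans_lt ?_
    rw [dist_eq_norm] at ht
    nlinarith [norm_nonneg (ψ t - ψ t₀), norm_nonneg y]

lemma avgTranslate_toLp_ae {a : G → ℂ} (ha : Integrable a μ) (y : C(G, ℂ)) :
    avgTranslate ha (ContinuousMap.toLp 2 μ ℂ y) =ᵐ[μ] fun t => ∫ s, a s * y (t - s) ∂μ := by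
  let g : C(G, C(G, ℂ)) := (ContinuousMap.mk (fun p : G × G => y (p.2 - p.1)) (by fun_prop)).curry
  have hg : ∀ s t, g s t = y (t - s) := fun _ _ => rfl
  have hτ : ∀ s, translate μ s (ContinuousMap.toLp 2 μ ℂ y) = ContinuousMap.toLp 2 μ ℂ (g s) := by
    intro s
    apply Lp.ext
    have h := (measurePreserving_sub_right μ s).quasiMeasurePreserving.ae_eq_comp
      (ContinuousMap.coeFn_toLp (p := 2) (𝕜 := ℂ) μ y)
    filter_upwards [translate_ae s (ContinuousMap.toLp 2 μ ℂ y), h,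
      ContinuousMap.coeFn_toLp (p := 2) (𝕜 := ℂ) μ (g s)] with t h1 h2 h3
    rw [h1, h3, hg]
    exact h2
  have hgi : Integrable (fun s => a s • g s) μ :=
    ha.smul_bdd (C := ‖g‖) (g.continuous.stronglyMeasurable_of_hasCompactSupport
      (.of_compactSpace _)).aestronglyMeasurable (ae_of_all _ fun s => g.norm_coe_le_norm s)
  have h1 : avgTranslate ha (ContinuousMap.toLp 2 μ ℂ y)
      = ContinuousMap.toLp 2 μ ℂ (∫ s, a s • g s ∂μ) := by
    rw [avgTranslate_apply, ← ContinuousLinearMap.integral_comp_comm _ hgi]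
    simp [hτ]
  rw [h1]
  filter_upwards [ContinuousMap.coeFn_toLp (p := 2) (𝕜 := ℂ) μ (∫ s, a s • g s ∂μ)] with t ht
  rw [ht, ContinuousMap.integral_apply hgi]
  rfl

lemma integrable_coeFn (x : Lp ℂ 2 μ) : Integrable x μ :=
  (Lp.memLp x).integrable (by norm_num)

lemma toLp_kernelOp (x y : Lp ℂ 2 μ) :
    BoundedContinuousFunction.toLp 2 μ ℂ (kernelOp (reflTranslate x) y)
      = avgTranslate (integrable_coeFn x) y := by
  have hd := ContinuousMap.toLp_denseRange ℂ μ ℂ (p := 2) (by simp)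
  refine congrFun (hd.equalizer
    ((BoundedContinuousFunction.toLp 2 μ ℂ).comp (kernelOp (reflTranslate x))).continuous
    (avgTranslate (integrable_coeFn x)).continuous ?_) y
  ext1 y
  apply Lp.ext
  filter_upwards [avgTranslate_toLp_ae (integrable_coeFn x) y,
    BoundedContinuousFunction.coeFn_toLp (p := 2) μ (𝕜 := ℂ)
      (kernelOp (reflTranslate x) (ContinuousMap.toLp 2 μ ℂ y))] with t h1 h2
  refine Eq.trans (h2 : _) ?_
  simp only [Function.comp]
  rw [h1, kernelOp_apply, inner_reflTranslate]
  refine integral_congr_ae ?_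
  have h := (Measure.measurePreserving_sub_left μ t).quasiMeasurePreserving.ae_eq_comp
      (ContinuousMap.coeFn_toLp (p := 2) (𝕜 := ℂ) μ y)
  filter_upwards [h] with s hs
  simp only [Function.comp] at hs
  rw [hs]

lemma avgTranslate_ae_of_memLp {a : G → ℂ} (ha : Integrable a μ) (ha2 : MemLp a 2 μ)
    (y : Lp ℂ 2 μ) :
    avgTranslate ha y =ᵐ[μ] fun t => ∫ s, a s * y (t - s) ∂μ := by
  have h0 := ha2.coeFn_toLp
  have h1 : avgTranslate ha y = avgTranslate (integrable_coeFn (ha2.toLp a)) y := by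
    rw [avgTranslate_apply, avgTranslate_apply]
    refine integral_congr_ae ?_
    filter_upwards [h0] with s hs
    rw [hs]
  rw [h1, ← toLp_kernelOp]
  filter_upwards [BoundedContinuousFunction.coeFn_toLp (p := 2) μ (𝕜 := ℂ)
      (kernelOp (reflTranslate (ha2.toLp a)) y)] with t h2
  rw [h2, kernelOp_apply, inner_reflTranslate]
  refine integral_congr_ae ?_
  filter_upwards [h0] with s hs
  rw [hs]

end L2

/-! ### Averages of translates are convolutions -/

section L2
variable {μ : Measure G} [μ.IsAddHaarMeasure] [IsProbabilityMeasure μ] [μ.Regular]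

lemma lintegral_conv_le {a : G → ℂ} (ha : Integrable a μ) (ha2 : MemLp a 2 μ) (y : Lp ℂ 2 μ) :
    AEMeasurable (fun t => ∫⁻ s, ‖a s * y (t - s)‖ₑ ∂μ) μ ∧
    ∫⁻ t, ∫⁻ s, ‖a s * y (t - s)‖ₑ ∂μ ∂μ ≤ ENNReal.ofReal ((∫ s, ‖a s‖ ∂μ) * ‖y‖) := by
  have hb : Integrable (fun s => (‖a s‖ : ℂ)) μ := ha.norm.ofReal
  have hb2 : MemLp (fun s => (‖a s‖ : ℂ)) 2 μ := ha2.norm.ofReal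
  have hy : MemLp (fun s => (‖y s‖ : ℂ)) 2 μ := (Lp.memLp y).norm.ofReal
  have hyn : ‖hy.toLp _‖ = ‖y‖ := by
    rw [Lp.norm_toLp, Lp.norm_def]
    congr 1
    exact eLpNorm_congr_norm_ae (ae_of_all _ fun s => by simp)
  have hae : (fun t => ∫⁻ s, ‖a s * y (t - s)‖ₑ ∂μ)
      =ᵐ[μ] fun t => ‖avgTranslate hb (hy.toLp _) t‖ₑ := by
    filter_upwards [avgTranslate_ae_of_memLp hb hb2 (hy.toLp _)] with t ht
    have hint : Integrable (fun s => a s * y (t - s)) μ :=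
      ha2.integrable_mul ((Lp.memLp y).comp_measurePreserving
        (Measure.measurePreserving_sub_left μ t))
    have h1 : ∫ s, (‖a s‖ : ℂ) * hy.toLp _ (t - s) ∂μ
        = ((∫ s, ‖a s * y (t - s)‖ ∂μ : ℝ) : ℂ) := by
      rw [← integral_complex_ofReal]
      refine integral_congr_ae ?_
      filter_upwards [(Measure.measurePreserving_sub_left μ t).quasiMeasurePreserving.ae_eq_comp
        hy.coeFn_toLp] with s hs
      simp only [Function.comp] at hs
      simp [hs]
    rw [ht, h1, ← ofReal_norm, Complex.norm_real, Real.norm_of_nonneg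
      (integral_nonneg fun _ => norm_nonneg _), ofReal_integral_norm_eq_lintegral_enorm hint]
  refine ⟨((Lp.aestronglyMeasurable _).enorm).congr hae.symm, ?_⟩
  rw [lintegral_congr_ae hae, ← eLpNorm_one_eq_lintegral_enorm]
  refine (eLpNorm_le_eLpNorm_of_exponent_le (q := 2) (by norm_num)
    (Lp.aestronglyMeasurable _)).trans ?_
  rw [← Lp.enorm_def, ← ofReal_norm]
  refine ENNReal.ofReal_le_ofReal ((norm_avgTranslate_le hb _).trans ?_)
  simp [hyn]

lemma avgTranslate_ae_aux {a : G → ℂ} (ha : Integrable a μ) (hm : StronglyMeasurable a)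
    (y : Lp ℂ 2 μ) :
    avgTranslate ha y =ᵐ[μ] fun t => ∫ s, a s * y (t - s) ∂μ := by
  let W : ℕ → Set G := fun N => {s | ‖a s‖ ≤ N}
  have hW : ∀ N, MeasurableSet (W N) := fun N => measurableSet_le hm.norm.measurable (by fun_prop)
  let b : ℕ → G → ℂ := fun N => (W N).indicator a
  have hb : ∀ N, Integrable (b N) μ := fun N => ha.indicator (hW N)
  have hb2 : ∀ N, MemLp (b N) 2 μ := fun N => by
    refine MemLp.of_bound (hb N).1 N (ae_of_all _ fun s => ?_)
    by_cases hs : s ∈ W N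
    · rw [show b N s = a s from Set.indicator_of_mem hs a]
      exact hs
    · simp [b, hs]
  have hble : ∀ N s, ‖b N s‖ ≤ ‖a s‖ := fun N s => norm_indicator_le_norm_self _ _
  have hev : ∀ s, ∀ᶠ N in atTop, b N s = a s := fun s => by
    obtain ⟨N, hN⟩ := exists_nat_ge ‖a s‖
    filter_upwards [eventually_ge_atTop N] with M hM
    have : s ∈ W M := hN.trans (by exact_mod_cast hM)
    simp [b, this]
  have hmono : ∀ t, Monotone fun N => ∫⁻ s, ‖b N s * y (t - s)‖ₑ ∂μ := fun t N M hNM => by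
    refine lintegral_mono fun s => ?_
    simp only [enorm_mul]
    gcongr 1
    by_cases hs : s ∈ W N
    · have : s ∈ W M := le_trans (b := (N : ℝ)) hs (by exact_mod_cast hNM)
      simp [b, hs, this]
    · simp [b, hs]
  have hsm : ∀ t, AEStronglyMeasurable (fun s => y (t - s)) μ := fun t =>
    (Lp.aestronglyMeasurable y).comp_measurePreserving (Measure.measurePreserving_sub_left μ t)
  have hsup : ∀ t, ∫⁻ s, ‖a s * y (t - s)‖ₑ ∂μ ≤ ⨆ N, ∫⁻ s, ‖b N s * y (t - s)‖ₑ ∂μ := by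
    intro t
    refine le_of_tendsto_of_tendsto (lintegral_tendsto_of_tendsto_of_monotone
      (fun N => (((hb N).1.mul (hsm t)).enorm)) (ae_of_all _ fun s N M hNM => ?_)
      (ae_of_all _ fun s => ?_)) (tendsto_atTop_iSup (hmono t))
      (Eventually.of_forall fun N => le_rfl)
    · simp only [Pi.mul_apply, enorm_mul]
      gcongr 1
      by_cases hs : s ∈ W N
      · have : s ∈ W M := le_trans (b := (N : ℝ)) hs (by exact_mod_cast hNM)
        simp [b, hs, this]
      · simp [b, hs]
    · refine tendsto_const_nhds.congr' ?_
      filter_upwards [hev s] with N hN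
      rw [Pi.mul_apply, hN]
  have hfin : ∀ᵐ t ∂μ, ∫⁻ s, ‖a s * y (t - s)‖ₑ ∂μ < ∞ := by
    have hmeas := fun N => (lintegral_conv_le (hb N) (hb2 N) y).1
    have : ∫⁻ t, ⨆ N, ∫⁻ s, ‖b N s * y (t - s)‖ₑ ∂μ ∂μ ≠ ∞ := by
      rw [lintegral_iSup' hmeas (ae_of_all _ hmono)]
      refine ne_top_of_le_ne_top (b := ENNReal.ofReal ((∫ s, ‖a s‖ ∂μ) * ‖y‖))
        ENNReal.ofReal_ne_top (iSup_le fun N => ?_)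
      refine (lintegral_conv_le (hb N) (hb2 N) y).2.trans (ENNReal.ofReal_le_ofReal ?_)
      gcongr
      · exact (hb N).norm
      · exact ha.norm
      · exact fun s => hble N s
    filter_upwards [ae_lt_top' (AEMeasurable.iSup hmeas) this] with t ht
    exact (hsup t).trans_lt ht
  have hconv : Tendsto (fun N => avgTranslate (hb N) y) atTop (𝓝 (avgTranslate ha y)) := by
    simp only [avgTranslate_apply]
    refine tendsto_integral_of_dominated_convergence (fun s => ‖a s‖ * ‖y‖)
      (fun N => (integrable_translate (hb N) y).1) (ha.norm.mul_const _) (fun N => ?_) ?_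
    · refine ae_of_all _ fun s => ?_
      rw [norm_smul, LinearIsometry.norm_map]
      gcongr
      exact hble N s
    · refine ae_of_all _ fun s => tendsto_const_nhds.congr' ?_
      filter_upwards [hev s] with N hN
      rw [hN]
  obtain ⟨ns, hns, hlim⟩ := (tendstoInMeasure_of_tendsto_Lp hconv).exists_seq_tendsto_ae
  have hall := ae_all_iff.2 fun N => avgTranslate_ae_of_memLp (hb N) (hb2 N) y
  filter_upwards [hfin, hlim, hall] with t h1 h2 h3
  refine tendsto_nhds_unique h2 ?_
  simp only [h3]
  refine Tendsto.comp (g := fun N => ∫ s, b N s * y (t - s) ∂μ) ?_ hns.tendsto_atTop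
  refine tendsto_integral_of_dominated_convergence (fun s => ‖a s * y (t - s)‖)
    (fun N => (hb N).1.mul (hsm t)) ?_ (fun N => ?_) ?_
  · exact (show Integrable (fun s => a s * y (t - s)) μ from ⟨ha.1.mul (hsm t), h1⟩).norm
  · refine ae_of_all _ fun s => ?_
    rw [norm_mul, norm_mul]
    gcongr
    exact hble N s
  · refine ae_of_all _ fun s => tendsto_const_nhds.congr' ?_
    filter_upwards [hev s] with N hN
    rw [hN]

lemma avgTranslate_ae {a : G → ℂ} (ha : Integrable a μ) (y : Lp ℂ 2 μ) :
    avgTranslate ha y =ᵐ[μ] fun t => ∫ s, a s * y (t - s) ∂μ := by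
  have h0 := ha.1.ae_eq_mk
  have ha' : Integrable (ha.1.mk a) μ := ha.congr h0
  have h1 : avgTranslate ha y = avgTranslate ha' y := by
    rw [avgTranslate_apply, avgTranslate_apply]
    refine integral_congr_ae ?_
    filter_upwards [h0] with s hs
    rw [hs]
  rw [h1]
  filter_upwards [avgTranslate_ae_aux ha' ha.1.stronglyMeasurable_mk y] with t ht
  rw [ht]
  refine integral_congr_ae ?_
  filter_upwards [h0] with s hs
  rw [hs]

end L2

/-! ### Completeness of the characters in `L²` -/

lemma exists_common_eigenvector {ι V : Type*} [AddCommGroup V] [Module ℂ V] (f : ι → V →ₗ[ℂ] V)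
    (hf : ∀ i k v, f i (f k v) = f k (f i v)) (n : ℕ) :
    ∀ E : Submodule ℂ V, FiniteDimensional ℂ E → Module.finrank ℂ E ≤ n → E ≠ ⊥ →
      (∀ i, ∀ v ∈ E, f i v ∈ E) → ∃ v ∈ E, v ≠ 0 ∧ ∀ i, ∃ c : ℂ, f i v = c • v := by
  induction n with
  | zero =>
    intro E _ hn hE _
    exact absurd (Submodule.finrank_eq_zero.1 (Nat.le_zero.1 hn)) hE
  | succ n ih =>
    intro E _ hn hE hinv
    by_cases h : ∀ i, ∃ c : ℂ, ∀ v ∈ E, f i v = c • v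
    · obtain ⟨v, hv, hv0⟩ := E.ne_bot_iff.1 hE
      exact ⟨v, hv, hv0, fun i => (h i).imp fun c hc => hc v hv⟩
    · push Not at h
      obtain ⟨i, hi⟩ := h
      have : Nontrivial E := Submodule.nontrivial_iff_ne_bot.2 hE
      obtain ⟨c, hc⟩ := Module.End.exists_eigenvalue ((f i).restrict (hinv i))
      obtain ⟨⟨w, hwE⟩, hw⟩ := hc.exists_hasEigenvector
      have hw1 : f i w = c • w := congrArg Subtype.val hw.apply_eq_smul
      have hw0 : w ≠ 0 := fun h0 => hw.2 (Subtype.ext h0)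
      let E' : Submodule ℂ V := E ⊓ LinearMap.ker (f i - c • LinearMap.id)
      have hmem : ∀ v, v ∈ E' ↔ v ∈ E ∧ f i v = c • v := fun v => by
        simp [E', sub_eq_zero]
      have hlt : E' < E := by
        refine lt_of_le_of_ne inf_le_left fun heq => ?_
        obtain ⟨v, hv, hne⟩ := hi c
        rw [← heq] at hv
        exact hne ((hmem v).1 hv).2
      have hfd : FiniteDimensional ℂ E' := Submodule.finiteDimensional_of_le hlt.le
      obtain ⟨v, hv, h⟩ := ih E' hfd
        (Nat.lt_succ_iff.1 ((Submodule.finrank_lt_finrank_of_lt hlt).trans_le hn))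
        (E'.ne_bot_iff.2 ⟨w, (hmem w).2 ⟨hwE, hw1⟩, hw0⟩) (fun k v hv => by
          rw [hmem] at hv ⊢
          exact ⟨hinv k v hv.1, by rw [hf, hv.2, map_smul]⟩)
      exact ⟨v, hlt.le hv, h⟩

section L2
variable (μ : Measure G) [μ.IsAddHaarMeasure] [IsProbabilityMeasure μ] [μ.Regular]

/-- The Fourier basis element `e_ξ` of `L²`. -/
def fourierBasis (ξ : DualGroup G) : Lp ℂ 2 μ := ContinuousMap.toLp 2 μ ℂ (character ξ)

variable {μ}

lemma fourierBasis_ae (ξ : DualGroup G) : fourierBasis μ ξ =ᵐ[μ] character ξ :=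
  ContinuousMap.coeFn_toLp (p := 2) (𝕜 := ℂ) μ _

lemma inner_fourierBasis (ξ : DualGroup G) (u : Lp ℂ 2 μ) :
    ⟪fourierBasis μ ξ, u⟫_ℂ = groupFourier μ u ξ := by
  rw [L2.inner_def]
  refine integral_congr_ae ?_
  filter_upwards [fourierBasis_ae ξ] with t ht
  simp [ht]

lemma character_add (ξ : DualGroup G) (s t : G) :
    character ξ (s + t) = character ξ s * character ξ t := by
  simp [character]

lemma character_neg (ξ : DualGroup G) (s : G) : character ξ (-s) = conj (character ξ s) := by
  have : character ξ (-s) = ((ξ (Multiplicative.ofAdd s))⁻¹ : Circle) := by simp [character]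
  rw [this, Circle.coe_inv_eq_conj]
  rfl

lemma norm_character (ξ : DualGroup G) (s : G) : ‖character ξ s‖ = 1 :=
  Circle.norm_coe _

lemma translate_fourierBasis (s : G) (ξ : DualGroup G) :
    translate μ s (fourierBasis μ ξ) = conj (character ξ s) • fourierBasis μ ξ := by
  apply Lp.ext
  filter_upwards [translate_ae s (fourierBasis μ ξ),
    (measurePreserving_sub_right μ s).quasiMeasurePreserving.ae_eq_comp (fourierBasis_ae ξ),
    fourierBasis_ae ξ, Lp.coeFn_smul (conj (character ξ s)) (fourierBasis μ ξ)] with t h1 h2 h3 h4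
  simp only [Function.comp] at h2
  rw [h1, h2, h4, Pi.smul_apply, h3, sub_eq_add_neg, character_add, character_neg, smul_eq_mul,
    mul_comm]

lemma translate_translate (s r : G) (u : Lp ℂ 2 μ) :
    translate μ s (translate μ r u) = translate μ (s + r) u := by
  apply Lp.ext
  filter_upwards [translate_ae s (translate μ r u), translate_ae (s + r) u,
    (measurePreserving_sub_right μ s).quasiMeasurePreserving.ae_eq_comp (translate_ae r u)]
    with t h1 h2 h3
  simp only [Function.comp] at h3
  rw [h1, h2, h3, sub_sub]

lemma translate_zero (u : Lp ℂ 2 μ) : translate μ 0 u = u := by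
  apply Lp.ext
  filter_upwards [translate_ae 0 u] with t h1
  rw [h1, sub_zero]

lemma inner_translate_left (s : G) (u v : Lp ℂ 2 μ) :
    ⟪translate μ s u, v⟫_ℂ = ⟪u, translate μ (-s) v⟫_ℂ := by
  rw [← (translate μ s).inner_map_map u, translate_translate, add_neg_cancel, translate_zero]

lemma inner_avgTranslate {a : G → ℂ} (ha : Integrable a μ) (u v : Lp ℂ 2 μ) :
    ⟪v, avgTranslate ha u⟫_ℂ = ∫ s, a s * ⟪v, translate μ s u⟫_ℂ ∂μ := by
  rw [avgTranslate_apply, ← integral_inner (integrable_translate ha u)]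
  simp [inner_smul_right]

lemma translate_avgTranslate {a : G → ℂ} (ha : Integrable a μ) (r : G) (u : Lp ℂ 2 μ) :
    translate μ r (avgTranslate ha u) = avgTranslate ha (translate μ r u) := by
  rw [avgTranslate_apply, avgTranslate_apply]
  have := (translate μ r).toContinuousLinearMap.integral_comp_comm (integrable_translate ha u)
  simp only [LinearIsometry.coe_toContinuousLinearMap] at this
  rw [← this]
  simp [translate_translate, add_comm]

lemma isSymmetric_avgTranslate {a : G → ℂ} (ha : Integrable a μ) (hs : ∀ s, a (-s) = conj (a s)) :
    (avgTranslate ha).IsSymmetric := by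
  intro u v
  change ⟪avgTranslate ha u, v⟫_ℂ = ⟪u, avgTranslate ha v⟫_ℂ
  rw [inner_avgTranslate, ← inner_conj_symm, inner_avgTranslate, ← integral_conj,
    ← integral_neg_eq_self]
  congr with s
  rw [map_mul, hs, inner_conj_symm, inner_translate_left, Complex.conj_conj, neg_neg]

lemma isCompactOperator_avgTranslate {a : G → ℂ} (ha : Integrable a μ) (ha2 : MemLp a 2 μ) :
    IsCompactOperator (avgTranslate ha) := by
  have h1 : avgTranslate ha = (BoundedContinuousFunction.toLp 2 μ ℂ).comp
      (kernelOp (reflTranslate (ha2.toLp a))) := by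
    ext1 y
    rw [ContinuousLinearMap.comp_apply, toLp_kernelOp, avgTranslate_apply, avgTranslate_apply]
    refine integral_congr_ae ?_
    filter_upwards [ha2.coeFn_toLp] with s hs
    rw [hs]
  rw [h1]
  exact (isCompactOperator_kernelOp (reflTranslate (ha2.toLp a))).clm_comp
    (BoundedContinuousFunction.toLp 2 μ ℂ)

/-- A joint eigenvector of all translations that is orthogonal to all characters vanishes. -/
lemma eq_zero_of_joint_eigenvector {v : Lp ℂ 2 μ} (hv : ∀ ξ, ⟪fourierBasis μ ξ, v⟫_ℂ = 0)
    {χ : G → ℂ} (hχ : ∀ s, translate μ s v = χ s • v) {x : Lp ℂ 2 μ} {c : ℂ} (hc : c ≠ 0)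
    (hx : avgTranslate (integrable_coeFn x) v = c • v) : v = 0 := by
  by_contra hv0
  have hn : ‖v‖ ≠ 0 := norm_ne_zero_iff.2 hv0
  have hχn : ∀ s, ‖χ s‖ = 1 := fun s => by
    have := (translate μ s).norm_map v
    rw [hχ, norm_smul] at this
    exact mul_right_cancel₀ hn (by rw [this, one_mul])
  have hχa : ∀ s t, χ (s + t) = χ s * χ t := fun s t => by
    have h1 := hχ (s + t)
    rw [← translate_translate, hχ t, map_smul, hχ s, smul_smul] at h1
    rw [mul_comm]
    exact (smul_left_injective ℂ hv0 h1).symm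
  have hχc : Continuous χ := by
    have h2 : χ = fun s => ⟪v, translate μ s v⟫_ℂ / ⟪v, v⟫_ℂ := by
      ext s
      rw [hχ, inner_smul_right, mul_div_cancel_right₀ _ (inner_self_ne_zero.2 hv0)]
    rw [h2]
    exact (continuous_const.inner (continuous_translate v)).div_const _
  let ξ : DualGroup G :=
    { toFun := fun m => ⟨χ (-m.toAdd), by simp [Submonoid.unitSphere, hχn]⟩
      map_one' := by
        have h3 : χ 0 = 1 := by
          have h4 := hχ 0
          rw [translate_zero] at h4
          exact smul_left_injective ℂ hv0 (by simpa using h4.symm)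
        ext; simp [h3]
      map_mul' := fun m k => by
        apply Subtype.ext
        change χ (-(m.toAdd + k.toAdd)) = χ (-m.toAdd) * χ (-k.toAdd)
        rw [neg_add, hχa]
      continuous_toFun := by
        refine Continuous.subtype_mk ?_ _
        exact hχc.comp (continuous_toAdd.neg) }
  have hξ : ∀ t, character ξ t = χ (-t) := fun t => rfl
  let g := kernelOp (reflTranslate x) v
  have hg : ∀ t, g t = g 0 * character ξ t := fun t => by
    have h1 : ∫ s, x s * v (t - s) ∂μ = ∫ s, x s * (χ (-t) * v (0 - s)) ∂μ := by
      refine integral_congr_ae ?_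
      have h2 : (fun s => (translate μ (-t) v) (0 - s)) =ᵐ[μ] fun s => v (0 - s - (-t)) :=
        (Measure.measurePreserving_sub_left μ 0).quasiMeasurePreserving.ae_eq_comp
          (translate_ae (-t) v)
      have h3 : (fun s => (χ (-t) • v : Lp ℂ 2 μ) (0 - s)) =ᵐ[μ] fun s => χ (-t) * v (0 - s) :=
        (Measure.measurePreserving_sub_left μ 0).quasiMeasurePreserving.ae_eq_comp
          (Lp.coeFn_smul (χ (-t)) v)
      rw [hχ] at h2
      filter_upwards [h2, h3] with s h2 h3
      rw [← h3, h2]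
      congr 2
      abel
    rw [hξ, show g t = _ from inner_reflTranslate x v t, h1,
      show g 0 = _ from inner_reflTranslate x v 0, ← integral_mul_const]
    congr with s
    ring
  have hgv : c • v = g 0 • fourierBasis μ ξ := by
    rw [← hx, ← toLp_kernelOp]
    apply Lp.ext
    filter_upwards [BoundedContinuousFunction.coeFn_toLp (p := 2) μ (𝕜 := ℂ) g,
      Lp.coeFn_smul (g 0) (fourierBasis μ ξ), fourierBasis_ae (μ := μ) ξ] with t h1 h2 h3
    rw [h1, h2, Pi.smul_apply, h3, hg, smul_eq_mul]
  have h5 : ⟪c • v, c • v⟫_ℂ = 0 := by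
    conv_lhs => rw [hgv, inner_smul_left, ← hgv, inner_smul_right, hv]
    simp
  rw [inner_self_eq_zero, smul_eq_zero] at h5
  exact h5.elim hc hv0

/-- The Fourier transform is injective on `L²`. -/
theorem eq_zero_of_groupFourier_eq_zero (u : Lp ℂ 2 μ) (hu : ∀ ξ, groupFourier μ u ξ = 0) :
    u = 0 := by
  simp only [← inner_fourierBasis] at hu
  by_contra hu0
  have hn : 0 < ‖u‖ := norm_pos_iff.2 hu0
  -- a symmetric neighbourhood of `0` on which translation moves `u` only a little
  have h1 : ∀ᶠ s in 𝓝 (0 : G), ‖translate μ s u - u‖ < ‖u‖ / 2 := by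
    have := (continuous_translate u).tendsto 0
    rw [translate_zero] at this
    simpa [dist_eq_norm] using Metric.tendsto_nhds.1 this (‖u‖ / 2) (by positivity)
  obtain ⟨U, hU, hUo, hU0⟩ := eventually_nhds_iff.1 h1
  let W := U ∩ -U
  have hWo : IsOpen W := hUo.inter hUo.neg
  have hW0 : (0 : G) ∈ W := ⟨hU0, by simpa using hU0⟩
  have hWm : MeasurableSet W := hWo.measurableSet
  have hWneg : ∀ s, -s ∈ W ↔ s ∈ W := fun s => by simp [W, and_comm]
  have hWpos : 0 < μ.real W :=
    ENNReal.toReal_pos (hWo.measure_pos μ ⟨0, hW0⟩).ne' (measure_ne_top _ _)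
  let a : G → ℂ := W.indicator fun _ => 1
  have ha2 : MemLp a 2 μ := (memLp_const (1 : ℂ)).indicator hWm
  let x : Lp ℂ 2 μ := ha2.toLp a
  have ha : Integrable a μ := ha2.integrable (by norm_num)
  let T := avgTranslate ha
  have hTx : avgTranslate (integrable_coeFn x) = T := by
    ext1 y
    change _ = avgTranslate ha y
    rw [avgTranslate_apply, avgTranslate_apply]
    refine integral_congr_ae ?_
    filter_upwards [ha2.coeFn_toLp] with s hs
    rw [hs]
  have hTu : T u ≠ 0 := fun h0 => by
    have e1 : ∫ s, a s • (translate μ s u - u) ∂μ = -((μ.real W : ℂ) • u) := by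
      simp only [smul_sub]
      rw [integral_sub (integrable_translate ha u) (ha.smul_const u), integral_smul_const]
      change T u - _ = _
      rw [h0, zero_sub]
      simp [a, integral_indicator hWm]
    have e2 : ‖∫ s, a s • (translate μ s u - u) ∂μ‖ ≤ ∫ s, W.indicator (fun _ => ‖u‖ / 2) s ∂μ := by
      refine norm_integral_le_of_norm_le ((integrable_const _).indicator hWm)
        (ae_of_all _ fun s => ?_)
      by_cases hs : s ∈ W
      · simpa [a, hs] using (hU s hs.1).le
      · simp [a, hs]
    rw [e1, norm_neg, norm_smul, integral_indicator hWm] at e2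
    simp at e2
    rw [abs_of_pos hWpos] at e2
    nlinarith
  -- restriction of `T` to the orthogonal complement of the characters
  let V : Submodule ℂ (Lp ℂ 2 μ) := (Submodule.span ℂ (Set.range (fourierBasis μ)))ᗮ
  have hV : ∀ v, v ∈ V ↔ ∀ ξ, ⟪fourierBasis μ ξ, v⟫_ℂ = 0 := fun v => by
    constructor
    · exact fun h ξ => h _ (Submodule.subset_span ⟨ξ, rfl⟩)
    · intro h w hw
      induction hw using Submodule.span_induction with
      | mem w hw => obtain ⟨ξ, rfl⟩ := hw; exact h ξ
      | zero => simp
      | add w w' _ _ h h' => rw [inner_add_left, h, h', add_zero]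
      | smul r w _ h => rw [inner_smul_left, h, mul_zero]
  have hVτ : ∀ s, ∀ v ∈ V, translate μ s v ∈ V := fun s v hv => by
    rw [hV] at hv ⊢
    intro ξ
    rw [← neg_neg s, ← inner_translate_left, translate_fourierBasis, inner_smul_left, hv, mul_zero]
  have hVT : ∀ v ∈ V, T v ∈ V := fun v hv => by
    rw [hV]
    intro ξ
    rw [inner_avgTranslate]
    simp [fun s => (hV _).1 (hVτ s v hv) ξ]
  have hVc : IsClosed (V : Set (Lp ℂ 2 μ)) := Submodule.isClosed_orthogonal _
  have : CompleteSpace V := hVc.completeSpace_coe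
  have hTc : IsCompactOperator T := isCompactOperator_avgTranslate ha ha2
  have hTs : T.IsSymmetric := isSymmetric_avgTranslate ha fun s => by
    by_cases hs : s ∈ W
    · simp [a, hs, hWneg]
    · simp [a, hs, hWneg]
  let S : V →L[ℂ] V := T.restrict hVT
  have hSc : IsCompactOperator S := IsCompactOperator.restrict' 
    (f := (T : Lp ℂ 2 μ →ₗ[ℂ] Lp ℂ 2 μ)) hTc hVT
  have hSs : S.IsSymmetric := hTs.restrict_invariant hVT
  have hS0 : S ≠ 0 := fun h0 => hTu <| by
    have := congrArg (fun A : V →L[ℂ] V => (A ⟨u, (hV u).2 hu⟩ : Lp ℂ 2 μ)) h0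
    exact this
  have := mt (ContinuousLinearMap.eq_zero_of_forall_hasEigenvalue_eq_zero hSc hSs).1 hS0
  push Not at this
  obtain ⟨c, hc, hc0⟩ := this
  let E : Submodule ℂ (Lp ℂ 2 μ) := V ⊓ LinearMap.ker ((T : Lp ℂ 2 μ →ₗ[ℂ] Lp ℂ 2 μ) - c • LinearMap.id)
  have hE : ∀ v, v ∈ E ↔ v ∈ V ∧ T v = c • v := fun v => by
    simp [E, sub_eq_zero]
  have hEfd : FiniteDimensional ℂ E := by
    have := ContinuousLinearMap.finite_dimensional_eigenspace hTc c hc0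
    refine Submodule.finiteDimensional_of_le
      (S₂ := Module.End.eigenspace (T : Lp ℂ 2 μ →ₗ[ℂ] Lp ℂ 2 μ) c) fun v hv => ?_
    rw [Module.End.mem_eigenspace_iff]
    exact ((hE v).1 hv).2
  have hE0 : E ≠ ⊥ := by
    obtain ⟨⟨w, hwV⟩, hw⟩ := hc.exists_hasEigenvector
    refine E.ne_bot_iff.2 ⟨w, (hE w).2 ⟨hwV, congrArg Subtype.val hw.apply_eq_smul⟩, fun h0 => ?_⟩
    exact hw.2 (Subtype.ext h0)
  obtain ⟨v, hv, hv0, hvχ⟩ := exists_common_eigenvector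
    (fun s => (translate μ s).toLinearMap)
    (fun s r v => by
      change translate μ s (translate μ r v) = translate μ r (translate μ s v)
      rw [translate_translate, translate_translate, add_comm])
    _ E hEfd le_rfl hE0 (fun s v hv => by
      rw [hE] at hv ⊢
      refine ⟨hVτ s v hv.1, ?_⟩
      change avgTranslate ha (translate μ s v) = c • translate μ s v
      rw [← translate_avgTranslate, ← map_smul]
      exact congrArg _ hv.2)
  choose χ hχ using hvχ
  rw [hE, hV] at hv
  exact hv0 (eq_zero_of_joint_eigenvector hv.1 hχ hc0 (x := x) (by rw [hTx]; exact hv.2))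
end L2

/-! ### The Fourier basis -/

section L2
variable (μ : Measure G) [μ.IsAddHaarMeasure] [IsProbabilityMeasure μ] [μ.Regular]

variable {μ}
lemma orthonormal_fourierBasis : Orthonormal ℂ (fourierBasis μ) := by
  classical
  rw [orthonormal_iff_ite]
  intro ξ η
  rw [L2.inner_def]
  have h0 : ∫ t, ⟪fourierBasis μ ξ t, fourierBasis μ η t⟫_ℂ ∂μ
      = ∫ t, conj (character ξ t) * character η t ∂μ := by
    refine integral_congr_ae ?_
    filter_upwards [fourierBasis_ae (μ := μ) ξ, fourierBasis_ae (μ := μ) η] with t h1 h2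
    simp [h1, h2, mul_comm]
  rw [h0]
  split_ifs with h
  · subst h
    have : ∀ t, conj (character ξ t) * character ξ t = 1 := fun t => by
      rw [Complex.conj_mul', norm_character]; simp
    simp [this]
  · by_contra hI
    refine h ?_
    have hs : ∀ s, character ξ s = character η s := fun s => by
      have h1 := integral_add_right_eq_self (μ := μ)
        (fun t => conj (character ξ t) * character η t) s
      have h2 : ∀ t, conj (character ξ (t + s)) * character η (t + s)
          = (conj (character ξ t) * character η t) * (conj (character ξ s) * character η s) :=
        fun t => by rw [character_add, character_add, map_mul]; ring
      simp only [h2] at h1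
      rw [integral_mul_const] at h1
      have h3 : conj (character ξ s) * character η s = 1 := by
        have := mul_left_cancel₀ hI (h1.trans (mul_one _).symm)
        exact this
      have h4 : character ξ s * conj (character ξ s) = 1 := by
        rw [Complex.mul_conj', norm_character]; simp
      calc character ξ s = character ξ s * (conj (character ξ s) * character η s) := by
            rw [h3, mul_one]
        _ = character η s := by rw [← mul_assoc, h4, one_mul]
    refine PontryaginDual.ext fun m => ?_
    exact Subtype.ext (hs m.toAdd)

variable (μ) in
/-- The characters form a Hilbert basis of `L²`. -/
def fourierHilbertBasis : HilbertBasis (DualGroup G) ℂ (Lp ℂ 2 μ) :=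
  HilbertBasis.mkOfOrthogonalEqBot (orthonormal_fourierBasis (μ := μ)) <| by
    rw [Submodule.eq_bot_iff]
    intro u hu
    refine eq_zero_of_groupFourier_eq_zero u fun ξ => ?_
    rw [← inner_fourierBasis]
    exact hu _ (Submodule.subset_span ⟨ξ, rfl⟩)

lemma fourierHilbertBasis_repr (u : Lp ℂ 2 μ) (ξ : DualGroup G) :
    (fourierHilbertBasis μ).repr u ξ = groupFourier μ u ξ := by
  rw [HilbertBasis.repr_apply_apply, fourierHilbertBasis, HilbertBasis.coe_mkOfOrthogonalEqBot,
    inner_fourierBasis]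

lemma groupFourier_add (u v : Lp ℂ 2 μ) (ξ : DualGroup G) :
    groupFourier μ (u + v : Lp ℂ 2 μ) ξ = groupFourier μ u ξ + groupFourier μ v ξ := by
  simp only [← inner_fourierBasis, inner_add_right]

lemma groupFourier_smul (c : ℂ) (u : Lp ℂ 2 μ) (ξ : DualGroup G) :
    groupFourier μ (c • u : Lp ℂ 2 μ) ξ = c * groupFourier μ u ξ := by
  simp only [← inner_fourierBasis, inner_smul_right]

lemma groupFourier_zero (ξ : DualGroup G) : groupFourier μ (0 : Lp ℂ 2 μ) ξ = 0 := by
  simp only [← inner_fourierBasis, inner_zero_right]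

/-! ### Convolution -/

variable (μ) in
/-- The convolution `(x ∗ y)(t) = ∫ x(τ) y(t - τ) dτ`. -/
def conv (x y : G → ℂ) : G → ℂ := fun t => ∫ τ, x τ * y (t - τ) ∂μ

lemma integrable_L1 (x : Lp ℂ 1 μ) : Integrable x μ := L1.integrable_coeFn x

lemma memLp_conv (x : Lp ℂ 1 μ) (y : Lp ℂ 2 μ) : MemLp (conv μ x y) 2 μ :=
  (Lp.memLp (avgTranslate (integrable_L1 x) y)).ae_eq (avgTranslate_ae (integrable_L1 x) y)

lemma toLp_conv (x : Lp ℂ 1 μ) (y : Lp ℂ 2 μ) :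
    (memLp_conv x y).toLp (conv μ x y) = avgTranslate (integrable_L1 x) y :=
  Lp.ext ((memLp_conv x y).coeFn_toLp.trans (avgTranslate_ae (integrable_L1 x) y).symm)

/-- For `x ∈ L¹`, the bounded operator `y ↦ x ∗ y` on `L²`. -/
def convOp (x : Lp ℂ 1 μ) : Lp ℂ 2 μ →L[ℂ] Lp ℂ 2 μ where
  toFun y := (memLp_conv x y).toLp (conv μ x y)
  map_add' y z := by simp only [toLp_conv, map_add]
  map_smul' c y := by simp only [toLp_conv, map_smul, RingHom.id_apply]
  cont := by simp only [toLp_conv]; fun_prop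

/-! ### The translation invariant hypothesis space -/

variable (G) in
/-- A family `(K̂_ξ)` indexed by the dual group with `0 ≤ K̂_ξ ≤ D²` for some `D > 0`. -/
structure SpectralWeight where
  /-- The value `K̂_ξ`. -/
  toFun : DualGroup G → ℝ
  nonneg : ∀ ξ, 0 ≤ toFun ξ
  bounded : ∃ D : ℝ, 0 < D ∧ ∀ ξ, toFun ξ ≤ D ^ 2

instance : CoeFun (SpectralWeight G) fun _ => DualGroup G → ℝ := ⟨SpectralWeight.toFun⟩

variable (μ) in
/-- The `w ∈ L²` with `∑ |(F w)_ξ|² / K̂_ξ < ∞` and `(F w)_ξ = 0` whenever `K̂_ξ = 0`. -/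
def hypothesisSubmodule (K : SpectralWeight G) : Submodule ℂ (Lp ℂ 2 μ) where
  carrier := {w | (∀ ξ, K ξ = 0 → groupFourier μ w ξ = 0) ∧
    Summable fun ξ => ‖groupFourier μ w ξ‖ ^ 2 / K ξ}
  zero_mem' := by
    simp only [Set.mem_ofPred_eq, groupFourier_zero]
    simp
  add_mem' := by
    rintro u v ⟨hu, hu'⟩ ⟨hv, hv'⟩
    refine ⟨fun ξ hξ => by rw [groupFourier_add, hu ξ hξ, hv ξ hξ, add_zero], ?_⟩
    refine Summable.of_nonneg_of_le (fun ξ => div_nonneg (by positivity) (K.nonneg ξ))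
      (fun ξ => ?_) ((hu'.add hv').mul_left 2)
    rw [groupFourier_add, ← add_div, ← mul_div_assoc]
    refine div_le_div_of_nonneg_right ?_ (K.nonneg ξ)
    have := norm_add_le (groupFourier μ u ξ) (groupFourier μ v ξ)
    nlinarith [sq_nonneg (‖groupFourier μ u ξ‖ - ‖groupFourier μ v ξ‖),
      norm_nonneg (groupFourier μ u ξ + groupFourier μ v ξ)]
  smul_mem' := by
    rintro c u ⟨hu, hu'⟩
    refine ⟨fun ξ hξ => by rw [groupFourier_smul, hu ξ hξ, mul_zero], ?_⟩
    refine (hu'.mul_left (‖c‖ ^ 2)).congr fun ξ => ?_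
    rw [groupFourier_smul, norm_mul, mul_pow, mul_div_assoc]

variable (μ) in
/-- The hypothesis space `H`. It carries its own norm and scalar product, defined below, and not those
of `L²`. -/
def HypothesisSpace (K : SpectralWeight G) : Type _ := hypothesisSubmodule μ K

namespace HypothesisSpace
variable {K : SpectralWeight G}

instance : AddCommGroup (HypothesisSpace μ K) :=
  inferInstanceAs (AddCommGroup (hypothesisSubmodule μ K))

instance : Module ℂ (HypothesisSpace μ K) :=
  inferInstanceAs (Module ℂ (hypothesisSubmodule μ K))

/-- The element of `L²` underlying an element of `H`. -/
def toL2 : HypothesisSpace μ K →ₗ[ℂ] Lp ℂ 2 μ := (hypothesisSubmodule μ K).subtype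

lemma toL2_injective : Function.Injective (toL2 : HypothesisSpace μ K → Lp ℂ 2 μ) :=
  Subtype.val_injective

lemma groupFourier_eq_zero (w : HypothesisSpace μ K) {ξ : DualGroup G} (h : K ξ = 0) :
    groupFourier μ (toL2 w) ξ = 0 := w.2.1 ξ h

lemma summable (w : HypothesisSpace μ K) :
    Summable fun ξ => ‖groupFourier μ (toL2 w) ξ‖ ^ 2 / K ξ := w.2.2

/-- The coordinates `(F w)_ξ / √K̂_ξ`. -/
def coords : HypothesisSpace μ K →ₗ[ℂ] lp (fun _ : DualGroup G => ℂ) 2 where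
  toFun w := ⟨fun ξ => groupFourier μ (toL2 w) ξ / (√(K ξ) : ℝ), by
    refine memℓp_gen ?_
    refine (summable w).congr fun ξ => ?_
    rw [norm_div, Complex.norm_real, Real.norm_of_nonneg (Real.sqrt_nonneg _)]
    simp [div_pow, Real.sq_sqrt (K.nonneg ξ)]⟩
  map_add' u v := by
    ext ξ
    simp only [map_add, groupFourier_add, add_div]
    rfl
  map_smul' c u := by
    ext ξ
    simp only [map_smul, groupFourier_smul, mul_div_assoc]
    rfl

lemma coords_apply (w : HypothesisSpace μ K) (ξ : DualGroup G) :
    coords w ξ = groupFourier μ (toL2 w) ξ / (√(K ξ) : ℝ) := rfl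

lemma sqrt_mul_coords (w : HypothesisSpace μ K) (ξ : DualGroup G) :
    (√(K ξ) : ℝ) * coords w ξ = groupFourier μ (toL2 w) ξ := by
  rw [coords_apply]
  by_cases h : K ξ = 0
  · rw [groupFourier_eq_zero w h]; simp
  · have : ((√(K ξ) : ℝ) : ℂ) ≠ 0 := by
      exact_mod_cast (Real.sqrt_ne_zero (K.nonneg ξ)).2 h
    field_simp

lemma coords_injective : Function.Injective (coords : HypothesisSpace μ K →ₗ[ℂ] _) := by
  rw [← LinearMap.ker_eq_bot, LinearMap.ker_eq_bot']
  intro w hw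
  apply toL2_injective
  rw [map_zero]
  refine eq_zero_of_groupFourier_eq_zero _ fun ξ => ?_
  rw [← sqrt_mul_coords, hw]
  simp

/-- The scalar product `∑ conj (F w)_ξ (F w')_ξ / K̂_ξ` of `H`, with Mathlib's convention that a scalar
product is conjugate-linear in the first variable. The terms with `K̂_ξ = 0` are zero. -/
def innerFun (w w' : HypothesisSpace μ K) : ℂ :=
  ∑' ξ, conj (groupFourier μ (toL2 w) ξ) * groupFourier μ (toL2 w') ξ / (K ξ : ℂ)

lemma innerFun_eq_coords (w w' : HypothesisSpace μ K) :
    innerFun w w' = ⟪coords w, coords w'⟫_ℂ := by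
  rw [innerFun, lp.inner_eq_tsum]
  congr with ξ
  have h : ((√(K ξ) : ℝ) : ℂ) * (√(K ξ) : ℝ) = (K ξ : ℂ) := by
    exact_mod_cast Real.mul_self_sqrt (K.nonneg ξ)
  rw [coords_apply, coords_apply, RCLike.inner_apply, map_div₀, Complex.conj_ofReal, ← h,
    div_mul_div_comm, mul_comm (groupFourier μ (toL2 w') ξ)]

/-- The Hilbert space axioms for `H`. -/
@[reducible] def core : InnerProductSpace.Core ℂ (HypothesisSpace μ K) where
  inner := innerFun
  conj_inner_symm w w' := by simp only [innerFun_eq_coords, inner_conj_symm]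
  re_inner_nonneg w := by
    rw [innerFun_eq_coords]
    exact inner_self_nonneg
  add_left u v w := by simp only [innerFun_eq_coords, map_add, inner_add_left]
  smul_left u v c := by simp only [innerFun_eq_coords, map_smul, inner_smul_left]
  definite w hw := by
    rw [innerFun_eq_coords, inner_self_eq_zero] at hw
    exact coords_injective (hw.trans (map_zero _).symm)

instance : NormedAddCommGroup (HypothesisSpace μ K) :=
  core.toNormedAddCommGroup

instance : InnerProductSpace ℂ (HypothesisSpace μ K) :=
  InnerProductSpace.ofCore core.toCore

lemma inner_def (w w' : HypothesisSpace μ K) : ⟪w, w'⟫_ℂ =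
    ∑' ξ, conj (groupFourier μ (toL2 w) ξ) * groupFourier μ (toL2 w') ξ / (K ξ : ℂ) := rfl

lemma inner_eq_coords (w w' : HypothesisSpace μ K) : ⟪w, w'⟫_ℂ = ⟪coords w, coords w'⟫_ℂ :=
  innerFun_eq_coords w w'

lemma norm_coords (w : HypothesisSpace μ K) : ‖coords w‖ = ‖w‖ := by
  rw [@norm_eq_sqrt_re_inner ℂ, @norm_eq_sqrt_re_inner ℂ _ _ _ _ w, ← inner_eq_coords]

lemma range_coords : Set.range (coords : HypothesisSpace μ K →ₗ[ℂ] _)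
    = {c | ∀ ξ, K ξ = 0 → c ξ = 0} := by
  ext c
  constructor
  · rintro ⟨w, rfl⟩ ξ hξ
    rw [coords_apply, groupFourier_eq_zero w hξ, zero_div]
  · intro hc
    obtain ⟨D, hD, hKD⟩ := K.bounded
    have hs : ∀ ξ, √(K ξ) ≤ D := fun ξ => (Real.sqrt_le_left hD.le).2 (hKD ξ)
    have hmem : Memℓp (fun ξ => ((√(K ξ) : ℝ) : ℂ) * c ξ) 2 := by
      have h2 : Memℓp (fun ξ => (D : ℂ) * c ξ) 2 := (lp.memℓp c).const_mul (D : ℂ)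
      refine memℓp_gen ?_
      refine Summable.of_nonneg_of_le (fun ξ => by positivity) (fun ξ => ?_)
        (h2.summable (by norm_num))
      simp only [norm_mul, Complex.norm_real, Real.norm_of_nonneg (Real.sqrt_nonneg _),
        Real.norm_of_nonneg hD.le]
      gcongr
      exact hs ξ
    let w : Lp ℂ 2 μ := (fourierHilbertBasis μ).repr.symm ⟨_, hmem⟩
    have hw : ∀ ξ, groupFourier μ w ξ = ((√(K ξ) : ℝ) : ℂ) * c ξ := fun ξ => by
      rw [← fourierHilbertBasis_repr, LinearIsometryEquiv.apply_symm_apply]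
    have hne : ∀ ξ, K ξ ≠ 0 → √(K ξ) ≠ 0 := fun ξ h => (Real.sqrt_ne_zero (K.nonneg ξ)).2 h
    refine ⟨⟨w, fun ξ hξ => by rw [hw, hξ]; simp, ?_⟩, ?_⟩
    · refine ((lp.memℓp c).summable (by norm_num)).congr fun ξ => ?_
      rw [hw]
      by_cases h : K ξ = 0
      · simp [h, hc ξ h]
      · simp only [norm_mul, Complex.norm_real, Real.norm_of_nonneg (Real.sqrt_nonneg _), mul_pow,
          Real.sq_sqrt (K.nonneg ξ)]
        field_simp
        simp
    · ext ξ
      refine (show _ = groupFourier μ w ξ / (√(K ξ) : ℝ) from rfl).trans ?_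
      rw [hw]
      by_cases h : K ξ = 0
      · simp [h, hc ξ h]
      · have : ((√(K ξ) : ℝ) : ℂ) ≠ 0 := by exact_mod_cast hne ξ h
        field_simp

instance : CompleteSpace (HypothesisSpace μ K) := by
  let L : HypothesisSpace μ K →ₗᵢ[ℂ] lp (fun _ : DualGroup G => ℂ) 2 := ⟨coords, norm_coords⟩
  have hcl : IsClosed (Set.range L) := by
    have : Set.range L = {c | ∀ ξ, K ξ = 0 → c ξ = 0} := range_coords
    rw [this]
    simp only [Set.ofPred_forall]
    refine isClosed_iInter fun ξ => isClosed_iInter fun _ => ?_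
    exact isClosed_eq ((lp.evalCLM ℂ (fun _ : DualGroup G => ℂ) (p := 2) ξ).continuous)
      continuous_const
  exact (completeSpace_iff_isComplete_range L.isometry.isUniformInducing).2 hcl.isComplete

/-- The canonical embedding `j : H → L²`. -/
def embed : HypothesisSpace μ K →L[ℂ] Lp ℂ 2 μ where
  toLinearMap := toL2
  cont := by
    obtain ⟨D, hD, hKD⟩ := K.bounded
    refine (toL2.mkContinuous D fun w => ?_).cont
    have hs : ∀ ξ, √(K ξ) ≤ D := fun ξ => (Real.sqrt_le_left hD.le).2 (hKD ξ)
    rw [← (fourierHilbertBasis μ).repr.norm_map, ← norm_coords w]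
    have h1 : ‖(D : ℂ) • coords w‖ = D * ‖coords w‖ := by
      rw [norm_smul, Complex.norm_real, Real.norm_of_nonneg hD.le]
    rw [← h1]
    refine lp.norm_mono (by norm_num) fun ξ => ?_
    rw [fourierHilbertBasis_repr, ← sqrt_mul_coords, norm_mul, lp.coeFn_smul, Pi.smul_apply,
      norm_smul, Complex.norm_real, Complex.norm_real, Real.norm_of_nonneg (Real.sqrt_nonneg _),
      Real.norm_of_nonneg hD.le]
    gcongr
    exact hs ξ

end HypothesisSpace
end L2

/-! ### Direct sums with the normalised norm -/

/-- The direct sum of `n` copies of `E`, with the norm `‖y‖² = (1/n) ∑ᵢ ‖yᵢ‖²`. -/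
def NormalizedSum (n : ℕ) (E : Type*) : Type _ := Fin n → E

namespace NormalizedSum
variable {n : ℕ} {E : Type*} [NormedAddCommGroup E] [InnerProductSpace ℂ E]

instance : AddCommGroup (NormalizedSum n E) := inferInstanceAs (AddCommGroup (Fin n → E))
instance : Module ℂ (NormalizedSum n E) := inferInstanceAs (Module ℂ (Fin n → E))

/-- The element `⊕ᵢ yᵢ`. -/
def of (y : Fin n → E) : NormalizedSum n E := y

/-- The scalar product `(1/n) ∑ᵢ ⟨xᵢ, yᵢ⟩`. -/
def innerFun (x y : NormalizedSum n E) : ℂ := (1 / n : ℂ) * ∑ i, ⟪x i, y i⟫_ℂ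

/-- Comparison with the direct sum with the norm `(∑ᵢ ‖yᵢ‖²)^(1/2)`. -/
def toPiLp : NormalizedSum n E ≃ₗ[ℂ] PiLp 2 (fun _ : Fin n => E) :=
  (WithLp.linearEquiv 2 ℂ (Fin n → E)).symm

lemma inner_toPiLp (x y : NormalizedSum n E) :
    ⟪toPiLp x, toPiLp y⟫_ℂ = n * innerFun x y := by
  rw [innerFun, PiLp.inner_apply]
  rcases Nat.eq_zero_or_pos n with rfl | hn
  · simp
  · have : (n : ℂ) ≠ 0 := by exact_mod_cast hn.ne'
    field_simp
    rfl

/-- The Hilbert space axioms for the normalised direct sum. -/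
@[reducible] def core : InnerProductSpace.Core ℂ (NormalizedSum n E) where
  inner := innerFun
  conj_inner_symm x y := by simp [innerFun]
  re_inner_nonneg x := by
    have h : innerFun x x = (((1 / n : ℝ) * ∑ i, ‖x i‖ ^ 2 : ℝ) : ℂ) := by
      rw [innerFun]; simp [inner_self_eq_norm_sq_to_K]
    rw [h]
    change 0 ≤ (1 / n : ℝ) * ∑ i, ‖x i‖ ^ 2
    positivity
  add_left x y z := by
    simp only [innerFun, ← mul_add, ← Finset.sum_add_distrib, ← inner_add_left]
    rfl
  smul_left x y c := by
    simp only [innerFun]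
    rw [mul_left_comm, Finset.mul_sum (a := conj c)]
    simp only [← inner_smul_left]
    rfl
  definite x hx := by
    have h := inner_toPiLp x x
    rw [hx, mul_zero, inner_self_eq_zero] at h
    exact toPiLp.injective (h.trans (map_zero _).symm)

instance : NormedAddCommGroup (NormalizedSum n E) := core.toNormedAddCommGroup

instance : InnerProductSpace ℂ (NormalizedSum n E) := InnerProductSpace.ofCore core.toCore

lemma inner_def (x y : NormalizedSum n E) : ⟪x, y⟫_ℂ = (1 / n : ℂ) * ∑ i, ⟪x i, y i⟫_ℂ := rfl

lemma norm_toPiLp (x : NormalizedSum n E) : ‖toPiLp x‖ = √n * ‖x‖ := by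
  rw [@norm_eq_sqrt_re_inner ℂ, @norm_eq_sqrt_re_inner ℂ _ _ _ _ x, inner_toPiLp,
    ← Real.sqrt_mul (by simp)]
  congr 1
  change ((n : ℂ) * innerFun x x).re = n * (innerFun x x).re
  simp

lemma norm_le_toPiLp (x : NormalizedSum n E) : ‖x‖ ≤ ‖toPiLp x‖ := by
  rcases Nat.eq_zero_or_pos n with rfl | hn
  · rw [show x = 0 from funext fun i => i.elim0]
    simp
  · rw [norm_toPiLp]
    refine le_mul_of_one_le_left (norm_nonneg _) ?_
    rw [Real.one_le_sqrt]
    exact_mod_cast hn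

lemma norm_toPiLp_symm_le (y : PiLp 2 (fun _ : Fin n => E)) :
    ‖(toPiLp.symm y : NormalizedSum n E)‖ ≤ 1 * ‖y‖ := by
  rw [one_mul]
  exact (norm_le_toPiLp (toPiLp.symm y)).trans_eq (by rw [LinearEquiv.apply_symm_apply])

/-- The comparison as a continuous linear equivalence. -/
def toPiLpL : NormalizedSum n E ≃L[ℂ] PiLp 2 (fun _ : Fin n => E) :=
  (toPiLp (n := n) (E := E)).toContinuousLinearEquivOfBounds (√n) 1
    (fun x => le_of_eq (norm_toPiLp x)) norm_toPiLp_symm_le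

instance [CompleteSpace E] : CompleteSpace (NormalizedSum n E) :=
  (completeSpace_congr (e := toPiLpL.toEquiv) (toPiLpL (n := n) (E := E)).isUniformEmbedding).2
    inferInstance

/-- The operator `w ↦ ⊕ᵢ Aᵢ w`. -/
def pi {F : Type*} [NormedAddCommGroup F] [InnerProductSpace ℂ F] (A : Fin n → F →L[ℂ] E) :
    F →L[ℂ] NormalizedSum n E where
  toFun w := of fun i => A i w
  map_add' u v := by funext i; exact map_add (A i) u v
  map_smul' c u := by funext i; exact map_smul (A i) c u
  cont := by
    refine (toPiLpL (n := n) (E := E)).symm.continuous.comp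
      (g := toPiLpL.symm) (f := fun w => WithLp.toLp 2 fun i => A i w) ?_
    fun_prop

end NormalizedSum

/-! ### Ridge regression -/

section Ridge
variable {μ : Measure G} [μ.IsAddHaarMeasure] [IsProbabilityMeasure μ] [μ.Regular]
  {K : SpectralWeight G} {n : ℕ}

variable (K) in
/-- The operator `Φ(x) : H → L²`, `Φ(x) w = x ∗ j(w)`. -/
def featureOp (x : Lp ℂ 1 μ) : HypothesisSpace μ K →L[ℂ] Lp ℂ 2 μ :=
  (convOp x).comp HypothesisSpace.embed

variable (K) in
/-- The sampling operator `S_n w = ⊕ᵢ Φ(Xᵢ) w`. -/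
def samplingOp (X : Fin n → Lp ℂ 1 μ) : HypothesisSpace μ K →L[ℂ] NormalizedSum n (Lp ℂ 2 μ) :=
  NormalizedSum.pi fun i => featureOp K (X i)

variable (K) in
/-- The operator `T_n = S_n^* S_n` on `H`, with `S_n^*` the Hilbert space adjoint. -/
def empiricalCov (X : Fin n → Lp ℂ 1 μ) : HypothesisSpace μ K →L[ℂ] HypothesisSpace μ K :=
  (ContinuousLinearMap.adjoint (samplingOp K X)).comp (samplingOp K X)

/-- The regularised empirical risk `(1/n) ∑ᵢ ‖Xᵢ ∗ j(w) - Yᵢ‖₂² + λ ‖w‖_H²`. -/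
def ridgeObjective (X : Fin n → Lp ℂ 1 μ) (Y : Fin n → Lp ℂ 2 μ) (lam : ℝ)
    (w : HypothesisSpace μ K) : ℝ :=
  1 / n * ∑ i, ‖convOp (X i) (HypothesisSpace.embed w) - Y i‖ ^ 2 + lam * ‖w‖ ^ 2

/-- `w` minimises the regularised empirical risk over `H`. -/
def IsRidgeEstimator (X : Fin n → Lp ℂ 1 μ) (Y : Fin n → Lp ℂ 2 μ) (lam : ℝ)
    (w : HypothesisSpace μ K) : Prop :=
  ∀ w' : HypothesisSpace μ K, ridgeObjective X Y lam w ≤ ridgeObjective X Y lam w'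

end Ridge

end RidgeConv

end

/-!
Write `S = S_n` for the sampling operator `samplingOp K X`. With the normalised norm on the direct
sum, the ridge functional is the Tikhonov functional `‖S w - Y‖² + λ ‖w‖²`
(`ridgeObjective_eq`). The operator `S⋆S + λ` is coercive, hence invertible
(`isUnit_adjoint_comp_self_add_smul`). If `w` solves the normal equation `(S⋆S + λ) w = S⋆ Y`, then
completing the square shows that the functional at `w + h` exceeds its value at `w` by exactly
`‖S h‖² + λ ‖h‖²` (`tikhonov_add`), so that `w` is the unique minimiser.

For the Fourier coefficients, the normal equation is tested against a character `ξ` with `K̂_ξ ≠ 0`,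
which is an element of `H` (`HypothesisSpace.ofCharacter`). Pairing with it in `H` is `(F ·)_ξ / K̂_ξ`,
and `S` maps it to `⊕ᵢ (F Xᵢ)_ξ ξ`, because characters are eigenvectors of convolution operators. The
normal equation therefore becomes a scalar linear equation for `(F w)_ξ`, with a positive
coefficient. If `K̂_ξ = 0`, `(F w)_ξ` vanishes by the definition of `H`.
-/

namespace RidgeConv

/-! ### Ridge regression in Hilbert spaces -/

section Abstract
variable {H E : Type*} [NormedAddCommGroup H] [InnerProductSpace ℂ H] [CompleteSpace H]
  [NormedAddCommGroup E] [InnerProductSpace ℂ E] [CompleteSpace E]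

/-- Tikhonov regularisation makes `S⋆S` invertible, because `S⋆S + λ` is coercive with constant
`λ`. -/
lemma isUnit_adjoint_comp_self_add_smul (S : H →L[ℂ] E) {lam : ℝ} (hlam : 0 < lam) :
    IsUnit ((ContinuousLinearMap.adjoint S).comp S + (lam : ℂ) • 1) := by
  refine ContinuousLinearMap.isUnit_of_forall_le_norm_inner_map _ (c := ⟨lam, hlam.le⟩) hlam
    fun w => ?_
  have h : ⟪((ContinuousLinearMap.adjoint S).comp S + (lam : ℂ) • 1) w, w⟫_ℂ
      = ((‖S w‖ ^ 2 + lam * ‖w‖ ^ 2 : ℝ) : ℂ) := by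
    simp [ContinuousLinearMap.adjoint_inner_left, inner_self_eq_norm_sq_to_K]
  rw [h, Complex.norm_real, Real.norm_of_nonneg (by positivity)]
  change ‖w‖ ^ 2 * lam ≤ _
  nlinarith [sq_nonneg ‖S w‖]

/-- Completing the square: at a solution `w` of the normal equation `(S⋆S + λ) w = S⋆ y`, the
first order term of the Tikhonov functional vanishes. -/
lemma tikhonov_add (S : H →L[ℂ] E) (y : E) {lam : ℝ} {w : H}
    (hw : ((ContinuousLinearMap.adjoint S).comp S + (lam : ℂ) • 1) w
      = ContinuousLinearMap.adjoint S y) (h : H) :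
    ‖S (w + h) - y‖ ^ 2 + lam * ‖w + h‖ ^ 2
      = (‖S w - y‖ ^ 2 + lam * ‖w‖ ^ 2) + (‖S h‖ ^ 2 + lam * ‖h‖ ^ 2) := by
  have h0 : ⟪S w - y, S h⟫_ℂ + lam * ⟪w, h⟫_ℂ = 0 := by
    have h1 := congrArg (fun v => ⟪v, h⟫_ℂ) hw
    simp only [add_apply, ContinuousLinearMap.comp_apply,
      smul_apply, one_apply_eq_self, inner_add_left,
      inner_smul_left, ContinuousLinearMap.adjoint_inner_left, Complex.conj_ofReal] at h1
    rw [inner_sub_left, ← h1]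
    ring
  have h2 := congrArg Complex.re h0
  rw [Complex.add_re, Complex.re_ofReal_mul, Complex.zero_re] at h2
  rw [map_add, add_sub_right_comm, @norm_add_sq ℂ, @norm_add_sq ℂ _ _ _ _ w h]
  change ‖S w - y‖ ^ 2 + 2 * (⟪S w - y, S h⟫_ℂ).re + ‖S h‖ ^ 2
    + lam * (‖w‖ ^ 2 + 2 * (⟪w, h⟫_ℂ).re + ‖h‖ ^ 2) = _
  linear_combination 2 * h2

end Abstract

/-! ### Convolution and the Fourier basis -/

section Fourier
variable {G : Type*} [AddCommGroup G] [TopologicalSpace G] [IsTopologicalAddGroup G]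
  [CompactSpace G] [MeasurableSpace G] [BorelSpace G]
  {μ : Measure G} [μ.IsAddHaarMeasure] [IsProbabilityMeasure μ] [μ.Regular]

/-- The characters are eigenvectors of convolution operators. -/
lemma convOp_fourierBasis (x : Lp ℂ 1 μ) (ξ : DualGroup G) :
    convOp x (fourierBasis μ ξ) = groupFourier μ x ξ • fourierBasis μ ξ := by
  change (memLp_conv x (fourierBasis μ ξ)).toLp _ = _
  rw [toLp_conv, avgTranslate_apply, groupFourier, ← integral_smul_const]
  simp only [translate_fourierBasis, smul_smul]

/-- The convolution theorem. -/
lemma groupFourier_convOp (x : Lp ℂ 1 μ) (y : Lp ℂ 2 μ) (ξ : DualGroup G) :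
    groupFourier μ (convOp x y) ξ = groupFourier μ x ξ * groupFourier μ y ξ := by
  have h : convOp x y = avgTranslate (integrable_L1 x) y := toLp_conv x y
  rw [h, ← inner_fourierBasis, inner_avgTranslate, groupFourier, ← integral_mul_const]
  refine integral_congr_ae (ae_of_all _ fun s => ?_)
  have h1 := inner_translate_left (-s) (fourierBasis μ ξ) y
  rw [neg_neg, translate_fourierBasis, inner_smul_left, character_neg, Complex.conj_conj,
    inner_fourierBasis] at h1
  simp only [← h1, mul_assoc]

lemma groupFourier_fourierBasis_self (ξ : DualGroup G) :
    groupFourier μ (fourierBasis μ ξ) ξ = 1 := by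
  rw [← inner_fourierBasis, inner_self_eq_norm_sq_to_K, orthonormal_fourierBasis.norm_eq_one]
  simp

lemma groupFourier_fourierBasis_of_ne {ξ η : DualGroup G} (h : η ≠ ξ) :
    groupFourier μ (fourierBasis μ ξ) η = 0 := by
  rw [← inner_fourierBasis]
  exact orthonormal_fourierBasis.2 h

namespace HypothesisSpace
variable {K : SpectralWeight G}

/-- The character `ξ` as an element of `H`, which it is if `K̂_ξ ≠ 0`. -/
noncomputable def ofCharacter {ξ : DualGroup G} (hξ : K ξ ≠ 0) : HypothesisSpace μ K :=
  ⟨fourierBasis μ ξ, fun η hη => groupFourier_fourierBasis_of_ne (by rintro rfl; exact hξ hη),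
    summable_of_ne_finset_zero (s := {ξ}) fun η hη => by
      rw [groupFourier_fourierBasis_of_ne (by simpa using hη)]
      simp⟩

lemma embed_ofCharacter {ξ : DualGroup G} (hξ : K ξ ≠ 0) :
    embed (ofCharacter hξ : HypothesisSpace μ K) = fourierBasis μ ξ := rfl

lemma inner_ofCharacter {ξ : DualGroup G} (hξ : K ξ ≠ 0) (w : HypothesisSpace μ K) :
    ⟪ofCharacter hξ, w⟫_ℂ = groupFourier μ (embed w) ξ / (K ξ : ℂ) := by
  have h : toL2 (ofCharacter hξ : HypothesisSpace μ K) = fourierBasis μ ξ := rfl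
  rw [inner_def, tsum_eq_single ξ fun η hη => by
    rw [h, groupFourier_fourierBasis_of_ne hη]; simp]
  rw [h, groupFourier_fourierBasis_self, map_one, one_mul]
  rfl

end HypothesisSpace

/-! ### The ridge estimator -/

variable {K : SpectralWeight G} {n : ℕ}

lemma ridgeObjective_eq (X : Fin n → Lp ℂ 1 μ) (Y : Fin n → Lp ℂ 2 μ) (lam : ℝ)
    (w : HypothesisSpace μ K) :
    ridgeObjective X Y lam w
      = ‖samplingOp K X w - NormalizedSum.of Y‖ ^ 2 + lam * ‖w‖ ^ 2 := by
  rw [ridgeObjective, @norm_sq_eq_re_inner ℂ _ _ _ _ (samplingOp K X w - NormalizedSum.of Y),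
    NormalizedSum.inner_def]
  congr 1
  have h : ∀ i, (samplingOp K X w - NormalizedSum.of Y) i
      = convOp (X i) (HypothesisSpace.embed w) - Y i := fun _ => rfl
  simp only [h, inner_self_eq_norm_sq_to_K]
  have h' : (1 / n : ℂ) * ∑ i, ((‖convOp (X i) (HypothesisSpace.embed w) - Y i‖ : ℝ) : ℂ) ^ 2
      = ((1 / n * ∑ i, ‖convOp (X i) (HypothesisSpace.embed w) - Y i‖ ^ 2 : ℝ) : ℂ) := by
    push_cast
    rfl
  exact (congrArg Complex.re h').symm

/-- A solution of the normal equation is the only minimiser of the ridge functional. -/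
lemma isRidgeEstimator_iff_eq {X : Fin n → Lp ℂ 1 μ} {Y : Fin n → Lp ℂ 2 μ} {lam : ℝ}
    (hlam : 0 < lam) {w : HypothesisSpace μ K}
    (hw : (empiricalCov K X + (lam : ℂ) • 1) w
      = ContinuousLinearMap.adjoint (samplingOp K X) (NormalizedSum.of Y))
    (w' : HypothesisSpace μ K) :
    IsRidgeEstimator X Y lam w' ↔ w' = w := by
  have key : ∀ v, ridgeObjective X Y lam v = ridgeObjective X Y lam w
      + (‖samplingOp K X (v - w)‖ ^ 2 + lam * ‖v - w‖ ^ 2) := fun v => by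
    rw [ridgeObjective_eq, ridgeObjective_eq, ← tikhonov_add (samplingOp K X) _ hw,
      add_sub_cancel]
  constructor
  · intro h
    have h1 := h w
    rw [key w'] at h1
    have h2 : lam * ‖w' - w‖ ^ 2 ≤ 0 := by nlinarith [sq_nonneg ‖samplingOp K X (w' - w)‖]
    have h3 : ‖w' - w‖ ^ 2 = 0 := le_antisymm (nonpos_of_mul_nonpos_right h2 hlam) (sq_nonneg _)
    exact sub_eq_zero.1 (norm_eq_zero.1 (pow_eq_zero_iff two_ne_zero |>.1 h3))
  · rintro rfl v
    rw [key v]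
    exact le_add_of_nonneg_right (by positivity)

/-- The pairing of `S⋆ Y` with a character involves only the Fourier coefficients at that character.
Applied to `Y = S w`, it also evaluates the left side of the normal equation. -/
lemma inner_samplingOp_ofCharacter (X : Fin n → Lp ℂ 1 μ) (Y : Fin n → Lp ℂ 2 μ)
    {ξ : DualGroup G} (hξ : K ξ ≠ 0) :
    ⟪samplingOp K X (HypothesisSpace.ofCharacter hξ), NormalizedSum.of Y⟫_ℂ
      = (1 / n : ℂ) * ∑ i, groupFourier μ (Y i) ξ * conj (groupFourier μ (X i) ξ) := by
  rw [NormalizedSum.inner_def]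
  congr 1
  refine Finset.sum_congr rfl fun i _ => ?_
  change ⟪convOp (X i) (fourierBasis μ ξ), Y i⟫_ℂ = _
  rw [convOp_fourierBasis, inner_smul_left, inner_fourierBasis, mul_comm]

/-- The Fourier coefficients of a solution of the normal equation. -/
lemma groupFourier_embed_of_normal_eq {X : Fin n → Lp ℂ 1 μ} {Y : Fin n → Lp ℂ 2 μ} {lam : ℝ}
    (hlam : 0 < lam) {w : HypothesisSpace μ K}
    (hw : (empiricalCov K X + (lam : ℂ) • 1) w
      = ContinuousLinearMap.adjoint (samplingOp K X) (NormalizedSum.of Y))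
    {ξ : DualGroup G} (hξ : K ξ ≠ 0) :
    groupFourier μ (HypothesisSpace.embed w) ξ =
      ((1 / n : ℂ) * ∑ i, groupFourier μ (Y i) ξ * conj (groupFourier μ (X i) ξ)) /
        ((1 / n : ℂ) * ∑ i, (‖groupFourier μ (X i) ξ‖ : ℂ) ^ 2 + (lam : ℂ) * (K ξ : ℂ)⁻¹) := by
  have hden : (1 / n : ℂ) * ∑ i, (‖groupFourier μ (X i) ξ‖ : ℂ) ^ 2
      + (lam : ℂ) * (K ξ : ℂ)⁻¹ ≠ 0 := by
    have hK : 0 < K ξ := (K.nonneg ξ).lt_of_ne' hξ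
    have : 0 < (1 / n : ℝ) * ∑ i, ‖groupFourier μ (X i) ξ‖ ^ 2 + lam * (K ξ)⁻¹ := by positivity
    have h := Complex.ofReal_ne_zero.2 this.ne'
    push_cast at h
    exact h
  have h1 := congrArg (fun v => ⟪HypothesisSpace.ofCharacter hξ, v⟫_ℂ) hw
  simp only [empiricalCov, add_apply, ContinuousLinearMap.comp_apply,
    smul_apply, one_apply_eq_self, inner_add_right,
    inner_smul_right, ContinuousLinearMap.adjoint_inner_right] at h1
  have h2 : samplingOp K X w
      = NormalizedSum.of fun i => convOp (X i) (HypothesisSpace.embed w) := rfl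
  rw [inner_samplingOp_ofCharacter, h2, inner_samplingOp_ofCharacter,
    HypothesisSpace.inner_ofCharacter] at h1
  rw [eq_div_iff hden, ← h1, mul_add, mul_left_comm, Finset.mul_sum]
  congr 1
  · congr 1
    refine Finset.sum_congr rfl fun i _ => ?_
    rw [groupFourier_convOp, ← Complex.mul_conj']
    ring
  · ring

end Fourier

end RidgeConv

theorem mainTheorem2 {G : Type*} [AddCommGroup G] [TopologicalSpace G] [IsTopologicalAddGroup G]
    [CompactSpace G] [MeasurableSpace G] [BorelSpace G]
    (μ : Measure G) [μ.IsAddHaarMeasure] [IsProbabilityMeasure μ] [μ.Regular]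
    (K : RidgeConv.SpectralWeight G) {n : ℕ} (hn : 0 < n)
    (X : Fin n → Lp ℂ 1 μ) (Y : Fin n → Lp ℂ 2 μ) {lam : ℝ} (hlam : 0 < lam) :
    IsUnit (RidgeConv.empiricalCov K X + (lam : ℂ) • 1) ∧
    ∃ w : RidgeConv.HypothesisSpace μ K,
      (RidgeConv.IsRidgeEstimator X Y lam w ∧
        ∀ w' : RidgeConv.HypothesisSpace μ K, RidgeConv.IsRidgeEstimator X Y lam w' → w' = w) ∧
      w = Ring.inverse (RidgeConv.empiricalCov K X + (lam : ℂ) • 1)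
        (ContinuousLinearMap.adjoint (RidgeConv.samplingOp K X)
          (RidgeConv.NormalizedSum.of Y)) ∧
      ∀ ξ : RidgeConv.DualGroup G,
        (K ξ ≠ 0 →
          RidgeConv.groupFourier μ (RidgeConv.HypothesisSpace.embed w) ξ =
            ((1 / n : ℂ) * ∑ i, RidgeConv.groupFourier μ (Y i) ξ *
              conj (RidgeConv.groupFourier μ (X i) ξ)) /
            ((1 / n : ℂ) * ∑ i, (‖RidgeConv.groupFourier μ (X i) ξ‖ : ℂ) ^ 2 +
              (lam : ℂ) * (K ξ : ℂ)⁻¹)) ∧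
        (K ξ = 0 → RidgeConv.groupFourier μ (RidgeConv.HypothesisSpace.embed w) ξ = 0) := by
  have hu : IsUnit (RidgeConv.empiricalCov K X + (lam : ℂ) • 1) :=
    RidgeConv.isUnit_adjoint_comp_self_add_smul (RidgeConv.samplingOp K X) hlam
  have hw : (RidgeConv.empiricalCov K X + (lam : ℂ) • 1)
      (Ring.inverse (RidgeConv.empiricalCov K X + (lam : ℂ) • 1)
        (ContinuousLinearMap.adjoint (RidgeConv.samplingOp K X) (RidgeConv.NormalizedSum.of Y)))
      = ContinuousLinearMap.adjoint (RidgeConv.samplingOp K X) (RidgeConv.NormalizedSum.of Y) := by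
    rw [← mul_apply_eq_comp, Ring.mul_inverse_cancel _ hu,
      one_apply_eq_self]
  have hmin := RidgeConv.isRidgeEstimator_iff_eq hlam hw
  exact ⟨hu, _, ⟨(hmin _).2 rfl, fun w' => (hmin w').1⟩, rfl, fun ξ =>
    ⟨RidgeConv.groupFourier_embed_of_normal_eq hlam hw,
      RidgeConv.HypothesisSpace.groupFourier_eq_zero _⟩⟩
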